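/- Theorem. Let $\mathbb{B}$ be a real reflexive Banach space that is $\mu$-strongly convex for some $\mu>0$, i.e. for $f(x)=\frac12\|x\|^2$, all $x,y\in\mathbb{B}$ and every subgradient $g\in\partial f(x)$ one has $f(y)\ge f(x)+\langle g,y-x\rangle+\frac{\mu}{2}\|x-y\|^2$. Consider unconstrained online linear optimization with hints: in round $t=1,2,\dots$ the algorithm, knowing the costs $c_1,\dots,c_{t-1}\in\mathbb{B}^*$ and the hints $h_1,\dots,h_t\in\mathbb{B}$, plays an arbitrary point $z_t\in\mathbb{B}$; all costs satisfy $\|c_t\|_*\le 1$ and all hints satisfy $\|h_t\|\le 1$. The regret of an algorithm $\mathcal{B}$ against $u\in\mathbb{B}$ is $\mathcal{R}_{\mathcal{B}}(u,\vec c,T\mid\vec h)=\sum_{t=1}^T\langle c_t,z_t-u\rangle$; for an algorithm without hints the regret $\mathcal{R}(u,\vec c,T)$ is defined in the same way. For $\alpha>0$ let $B^*_{T,\alpha}$ be a set $S\subseteq[T]$ of smallest cardinality such that $$\sum_{t\in[T]\setminus S}\langle c_t,h_t\rangle\ \ge\ \alpha\sum_{t\in[T]\setminus S}\|c_t\|_*^2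 ,$$ and for $\epsilon>0$ write $\Lambda(u)=\log\left(e+T+\|u\|/\epsilon\right)$ for the logarithmic factor hidden by the notation $\tilde O$. There are absolute constants $C>0$ and $k\in\mathbb{N}$ (not depending on $\mathbb{B},\mu,\epsilon,\alpha,T,u$, the costs or the hints) such that for every such $\mathbb{B}$ and $\mu$, and for every $\epsilon>0$, there is an algorithm $\mathcal{B}$ (depending only on $\mathbb{B},\mu,\epsilon$) that satisfies, for all costs and hints as above, all $T\ge 0$, all $\alpha>0$ and all $u\in\mathbb{B}$, $$\mathcal{R}_{\mathcal{B}}(u,\vec c,T\mid\vec h)\ \le\ C\,\Lambda(u)^k\left(\epsilon+\frac{\|u\|\,\log\left(1+\frac{T\|u\|}{\min\{\epsilon,\epsilon^2\}}\right)\left(1+\sqrt{|B^*_{T,\alpha}|}\right)}{\min\{\alpha,1\}\,\mu}\right).$$ In particular, for $0<\epsilon\le 1$ and $0<\alpha\le 1$ the right-hand side is $\tilde O\left(\epsilon+\frac{\|u\|\log(1+T\|u\|/\epsilon^2)\,(1+\sqrt{|B^*_{T,\alpha}|})}{\alpha\mu}\right)$. Moreover $\mathcal{B}$ is the sum of two parameter-free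 learners without hints: it plays $z_t=x_t-y_th_t$, where $x_t\in\mathbb{B}$ is the answer of a learner on $\mathbb{B}$ to the costs $c_1,\dots,c_{t-1}$, and $y_t\in\mathbb{R}$ is the answer of a learner on $\mathbb{R}$ to the scalar costs $-\langle c_1,h_1\rangle,\dots,-\langle c_{t-1},h_{t-1}\rangle$. Here a learner on a $\mu'$-strongly convex space is called parameter-free if, on every sequence of costs of norm at most $1$ and for every $T\ge 0$, its regret against $0$ is at most $\epsilon$ and its regret against every $u$ is at most $C\,\Lambda(u)^k\left(\epsilon+\|u\|\sqrt{(1+\sum_{t=1}^T\|c_t\|_*^2)/\mu'}\right)$; for the two learners $\mu'=\mu$ and $\mu'=1$, respectively. -/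

import Mathlib

open Finset

noncomputable section

/-! Geometry of the Banach space. -/

/-- The set of subgradients of `f` at `x`. -/
def subgradients {E : Type*} [NormedAddCommGroup E] [NormedSpace ℝ E]
    (f : E → ℝ) (x : E) : Set (StrongDual ℝ E) :=
  {g | ∀ y, f x + g (y - x) ≤ f y}

/-- `f` is `μ`-strongly convex with respect to the norm: for all `x`, `y` and all subgradients `g`
of `f` at `x`, `f y ≥ f x + ⟨g, y - x⟩ + (μ / 2) ‖x - y‖ ^ 2`. -/
def IsStronglyConvexFun {E : Type*} [NormedAddCommGroup E] [NormedSpace ℝ E]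
    (μ : ℝ) (f : E → ℝ) : Prop :=
  ∀ x y, ∀ g ∈ subgradients f x, f x + g (y - x) + μ / 2 * ‖x - y‖ ^ 2 ≤ f y

/-- The space `E` is `μ`-strongly convex: `x ↦ ‖x‖ ^ 2 / 2` is `μ`-strongly convex. -/
def IsStronglyConvexSpace (E : Type*) [NormedAddCommGroup E] [NormedSpace ℝ E] (μ : ℝ) : Prop :=
  IsStronglyConvexFun μ (fun x : E => 1 / 2 * ‖x‖ ^ 2)

/-- Reflexivity. The canonical map into the bidual is always a linear isometric embedding, so it is
an isomorphism of Banach spaces as soon as it is onto. -/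
def IsReflexiveSpace (E : Type*) [NormedAddCommGroup E] [NormedSpace ℝ E] : Prop :=
  Function.Surjective (NormedSpace.inclusionInDoubleDual ℝ E)

/-! Online linear optimization. Rounds are numbered `0, 1, 2, …`; the first `T` rounds are those in
`Finset.range T`. -/

/-- A deterministic algorithm for unconstrained online linear optimization without hints:
in round `t` it sees the costs of the rounds `0, …, t - 1` and plays a point of `E`. -/
def OnlineAlgorithm (E : Type*) [NormedAddCommGroup E] [NormedSpace ℝ E] :=
  (t : ℕ) → (Fin t → StrongDual ℝ E) → E

/-- A deterministic algorithm for unconstrained online linear optimization with hints: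
in round `t` it sees the costs of the rounds `0, …, t - 1` and the hints of the rounds `0, …, t`,
and plays a point of `E`. -/
def HintAlgorithm (E : Type*) [NormedAddCommGroup E] [NormedSpace ℝ E] :=
  (t : ℕ) → (Fin t → StrongDual ℝ E) → (Fin (t + 1) → E) → E

/-- The point played in round `t` on the cost sequence `c`. -/
def OnlineAlgorithm.play {E : Type*} [NormedAddCommGroup E] [NormedSpace ℝ E]
    (A : OnlineAlgorithm E) (c : ℕ → StrongDual ℝ E) (t : ℕ) : E :=
  A t (fun i => c i)

/-- The point played in round `t` on the cost sequence `c` and the hint sequence `h`. -/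
def HintAlgorithm.play {E : Type*} [NormedAddCommGroup E] [NormedSpace ℝ E]
    (B : HintAlgorithm E) (c : ℕ → StrongDual ℝ E) (h : ℕ → E) (t : ℕ) : E :=
  B t (fun i => c i) (fun i => h i)

/-- Regret after `T` rounds against the comparator `u`. -/
def OnlineAlgorithm.regret {E : Type*} [NormedAddCommGroup E] [NormedSpace ℝ E]
    (A : OnlineAlgorithm E) (c : ℕ → StrongDual ℝ E) (T : ℕ) (u : E) : ℝ :=
  ∑ t ∈ range T, c t (A.play c t - u)

/-- Regret after `T` rounds against the comparator `u`, in the presence of hints. -/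
def HintAlgorithm.regret {E : Type*} [NormedAddCommGroup E] [NormedSpace ℝ E]
    (B : HintAlgorithm E) (c : ℕ → StrongDual ℝ E) (h : ℕ → E) (T : ℕ) (u : E) : ℝ :=
  ∑ t ∈ range T, c t (B.play c h t - u)

/-- The logarithmic factor of which powers are hidden by the soft-O notation:
`log (e + T + r / ε)`, to be used with `r = ‖u‖`. It is at least `1` for `r ≥ 0`, `ε > 0`. -/
def logFactor (T : ℕ) (r ε : ℝ) : ℝ :=
  Real.log (Real.exp 1 + T + r / ε)

/-- `A` is a parameter-free learner with parameter `ε` on a `μ`-strongly convex space: on costs of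
norm at most `1`, its regret against `0` is at most `ε`, and its regret against every `u` is,
up to logarithmic factors, at most `ε + ‖u‖ √((1 + ∑ ‖c_t‖ ^ 2) / μ)`. -/
def IsParameterFree {E : Type*} [NormedAddCommGroup E] [NormedSpace ℝ E]
    (A : OnlineAlgorithm E) (μ ε C : ℝ) (k : ℕ) : Prop :=
  ∀ c : ℕ → StrongDual ℝ E, (∀ t, ‖c t‖ ≤ 1) → ∀ T : ℕ,
    A.regret c T 0 ≤ ε ∧
    ∀ u : E, A.regret c T u ≤
      C * logFactor T ‖u‖ ε ^ k *
        (ε + ‖u‖ * Real.sqrt ((1 + ∑ t ∈ range T, ‖c t‖ ^ 2) / μ))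

/-- The sum of a learner `A` on `E` and a learner `A₁` on `ℝ`: in round `t` it plays
`x_t - y_t h_t`, where `x_t` is the answer of `A` to the costs `c_0, …, c_{t-1}`, and `y_t` is the
answer of `A₁` to the scalar costs `-⟨c_0, h_0⟩, …, -⟨c_{t-1}, h_{t-1}⟩`. -/
def addLearners {E : Type*} [NormedAddCommGroup E] [NormedSpace ℝ E]
    (A : OnlineAlgorithm E) (A₁ : OnlineAlgorithm ℝ) : HintAlgorithm E :=
  fun t c h =>
    A t c - A₁ t (fun i => (-(c i (h i.castSucc))) • ContinuousLinearMap.id ℝ ℝ) • h (Fin.last t)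

/-- Outside the set `S` of rounds, the hints of the first `T` rounds are `α`-correlated with the
costs on average. -/
def CorrelatedOutside {E : Type*} [NormedAddCommGroup E] [NormedSpace ℝ E]
    (c : ℕ → StrongDual ℝ E) (h : ℕ → E) (T : ℕ) (α : ℝ) (S : Finset ℕ) : Prop :=
  α * ∑ t ∈ range T \ S, ‖c t‖ ^ 2 ≤ ∑ t ∈ range T \ S, c t (h t)

/-- The cardinality of a smallest set of rounds `S ⊆ {0, …, T - 1}` outside which the hints are
`α`-correlated with the costs on average. -/
def badCount {E : Type*} [NormedAddCommGroup E] [NormedSpace ℝ E]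
    (c : ℕ → StrongDual ℝ E) (h : ℕ → E) (T : ℕ) (α : ℝ) : ℕ :=
  sInf {n | ∃ S ⊆ range T, CorrelatedOutside c h T α S ∧ S.card = n}

/-- The minimum in `badCount` is attained. -/
theorem badCount_attained {E : Type*} [NormedAddCommGroup E] [NormedSpace ℝ E]
    (c : ℕ → StrongDual ℝ E) (h : ℕ → E) (T : ℕ) (α : ℝ) :
    ∃ S ⊆ range T, CorrelatedOutside c h T α S ∧ S.card = badCount c h T α :=
  Nat.sInf_mem (s := {n | ∃ S ⊆ range T, CorrelatedOutside c h T α S ∧ S.card = n})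
    ⟨_, range T, Subset.rfl, by simp [CorrelatedOutside], rfl⟩

end

/-! ### Subgradients and midpoint convexity of half the squared norm. -/

noncomputable section

/-! The regret of the summed learner splits exactly (`addLearners_regret`): for every scalar `y` it
is the regret of `A` at `u`, plus that of `A₁` at `y`, minus `y ∑ ⟨c_t, h_t⟩`. Only the analysis
chooses `y`, so the algorithm need not know `α` or the bad rounds. With `b` bad rounds and `V` the
sum of `‖c_t‖ ^ 2` over the others, the hints collect at least `αV - b`. Taking `y = ‖u‖ / max 1 (α
√(1 + b))`, the gain `yαV` pays for the `√V` part of both regrets by completing a square, and the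
loss `yb` stays of order `‖u‖ √b / α` (`hint_tradeoff`).

The parameter-free learner multiplies a direction by a length. The direction comes from
follow-the-regularized-leader on the unit ball (`ballLearner_regret_le`), where midpoint convexity
gives both existence of minimizers and stability. The length is the bet of a mixture of
constant-fraction bettors. Its wealth never becomes negative, which bounds the regret at `0`, and it
grows exponentially in the negated sum of the costs, which bounds the regret elsewhere
(`mul_sub_mixtureWealth_le`). -/

theorem mul_half_sq_midpoint_le {E : Type*} [NormedAddCommGroup E] [NormedSpace ℝ E] {μ : ℝ}
    (hE : IsStronglyConvexSpace E μ) (x y : E) :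
    1 / 2 * ‖(1 / 2 : ℝ) • (x + y)‖ ^ 2 + μ / 8 * ‖x - y‖ ^ 2 ≤
      1 / 2 * (1 / 2 * ‖x‖ ^ 2) + 1 / 2 * (1 / 2 * ‖y‖ ^ 2) := by
  set z : E := (1 / 2 : ℝ) • (x + y) with hz
  obtain ⟨φ, hφ, hφz⟩ := exists_dual_vector'' ℝ z
  have hφz : φ z = ‖z‖ := by simpa using hφz
  -- A norming functional scaled by the norm is a subgradient at the midpoint. In the average of the
  -- two strong convexity inequalities the linear terms cancel.
  have hg : ‖z‖ • φ ∈ subgradients (fun x : E => 1 / 2 * ‖x‖ ^ 2) z := by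
    intro w
    have h1 : φ w ≤ ‖w‖ := (le_abs_self _).trans ((φ.le_of_opNorm_le hφ w).trans_eq (one_mul _))
    have h2 := mul_le_mul_of_nonneg_left h1 (norm_nonneg z)
    simp only [smul_apply, map_sub, smul_eq_mul, hφz]
    nlinarith [sq_nonneg (‖z‖ - ‖w‖)]
  have hx := hE z x _ hg
  have hy := hE z y _ hg
  have e1 : z - x = (1 / 2 : ℝ) • (y - x) := by rw [hz]; module
  have e2 : z - y = (1 / 2 : ℝ) • (x - y) := by rw [hz]; module
  have e3 : φ z = 1 / 2 * (φ x + φ y) := by simp [hz]; ring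
  have n1 : ‖z - x‖ = 1 / 2 * ‖x - y‖ := by rw [e1, norm_smul, norm_sub_rev]; norm_num
  have n2 : ‖z - y‖ = 1 / 2 * ‖x - y‖ := by rw [e2, norm_smul]; norm_num
  simp only [smul_apply, map_sub, smul_eq_mul, n1, n2] at hx hy
  have e4 : ‖z‖ * φ z = 1 / 2 * (‖z‖ * φ x + ‖z‖ * φ y) := by rw [e3]; ring
  nlinarith

/-- At the origin `0` is a subgradient, so the quadratic gain cannot exceed half the squared norm
itself. -/
theorem IsStronglyConvexSpace.le_one {E : Type*} [NormedAddCommGroup E] [NormedSpace ℝ E] {μ : ℝ}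
    (hE : IsStronglyConvexSpace E μ) {u : E} (hu : u ≠ 0) : μ ≤ 1 := by
  have h0 : (0 : StrongDual ℝ E) ∈ subgradients (fun x : E => 1 / 2 * ‖x‖ ^ 2) 0 := by
    intro y
    simp
  have h := hE 0 u 0 h0
  have hpos : 0 < ‖u‖ ^ 2 := by positivity
  simp at h
  nlinarith

theorem isStronglyConvexSpace_real : IsStronglyConvexSpace ℝ 1 := by
  intro x y g hg
  have hlin : ∀ w : ℝ, g w = w * g 1 := fun w => by
    conv_lhs => rw [← mul_one w, ← smul_eq_mul, map_smul, smul_eq_mul]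
  -- Testing the subgradient inequality at its own slope forces the slope to be `x`.
  have h := hg (g 1)
  simp only [hlin (g 1 - x), Real.norm_eq_abs, sq_abs] at h
  have hx : g 1 - x = 0 := by nlinarith [sq_nonneg (g 1 - x)]
  have hx' : g 1 = x := by linarith
  simp only [hlin (y - x), Real.norm_eq_abs, sq_abs, hx']
  nlinarith

/-! ### Follow-the-regularized-leader on the unit ball. -/

/-- The objective of follow-the-regularized-leader. -/
def ftrlObjective {E : Type*} [NormedAddCommGroup E] [NormedSpace ℝ E]
    (θ : StrongDual ℝ E) (r : ℝ) (x : E) : ℝ :=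
  θ x + r * (1 / 2 * ‖x‖ ^ 2)

theorem ftrlObjective_midpoint {E : Type*} [NormedAddCommGroup E] [NormedSpace ℝ E] {μ : ℝ}
    (hE : IsStronglyConvexSpace E μ) (θ : StrongDual ℝ E) {r : ℝ} (hr : 0 ≤ r) (x y : E) :
    ftrlObjective θ r ((1 / 2 : ℝ) • (x + y)) + r * μ / 8 * ‖x - y‖ ^ 2 ≤
      1 / 2 * ftrlObjective θ r x + 1 / 2 * ftrlObjective θ r y := by
  have h := mul_le_mul_of_nonneg_left (mul_half_sq_midpoint_le hE x y) hr
  have hθ : θ ((1 / 2 : ℝ) • (x + y)) = 1 / 2 * (θ x + θ y) := by simp; ring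
  simp only [ftrlObjective, hθ]
  nlinarith

theorem norm_midpoint_le_one {E : Type*} [NormedAddCommGroup E] [NormedSpace ℝ E] {x y : E}
    (hx : ‖x‖ ≤ 1) (hy : ‖y‖ ≤ 1) : ‖(1 / 2 : ℝ) • (x + y)‖ ≤ 1 := by
  rw [norm_smul]
  have := norm_add_le x y
  norm_num
  linarith

theorem exists_ftrl_minimizer {E : Type*} [NormedAddCommGroup E] [NormedSpace ℝ E]
    [CompleteSpace E] {μ : ℝ} (hμ : 0 < μ) (hE : IsStronglyConvexSpace E μ)
    (θ : StrongDual ℝ E) {r : ℝ} (hr : 0 < r) :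
    ∃ x : E, ‖x‖ ≤ 1 ∧ ∀ y : E, ‖y‖ ≤ 1 → ftrlObjective θ r x ≤ ftrlObjective θ r y := by
  set F := ftrlObjective θ r with hF
  set K : Set E := {x | ‖x‖ ≤ 1} with hK
  have hbdd : BddBelow (F '' K) := by
    refine ⟨-‖θ‖, ?_⟩
    rintro _ ⟨x, hx, rfl⟩
    have h1 : |θ x| ≤ ‖θ‖ * 1 := θ.le_opNorm_of_le hx
    have h2 : 0 ≤ r * (1 / 2 * ‖x‖ ^ 2) := by positivity
    have h3 := neg_abs_le (θ x)
    simp only [hF, ftrlObjective]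
    linarith
  have hne : (F '' K).Nonempty := ⟨F 0, 0, by simp [hK], rfl⟩
  set m := sInf (F '' K) with hm
  have hmle : ∀ y, ‖y‖ ≤ 1 → m ≤ F y := fun y hy => csInf_le hbdd ⟨y, hy, rfl⟩
  have hseq : ∀ n : ℕ, ∃ x : E, ‖x‖ ≤ 1 ∧ F x < m + 1 / ((n : ℝ) + 1) := fun n => by
    obtain ⟨_, ⟨x, hx, rfl⟩, hlt⟩ := exists_lt_of_csInf_lt hne
      (show sInf (F '' K) < m + 1 / ((n : ℝ) + 1) by
        have : 0 < 1 / ((n : ℝ) + 1) := by positivity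
        linarith)
    exact ⟨x, hx, hlt⟩
  choose x hx hxm using hseq
  -- The midpoint of two near-minimizers cannot go below the infimum, so strong convexity forces
  -- them to be close.
  have hcauchy : CauchySeq x := by
    rw [Metric.cauchySeq_iff']
    intro δ hδ
    obtain ⟨N, hN⟩ := exists_nat_one_div_lt (show 0 < r * μ / 8 * δ ^ 2 by positivity)
    refine ⟨N, fun n hn => ?_⟩
    have h1 := ftrlObjective_midpoint hE θ hr.le (x n) (x N)
    have h2 := hmle _ (norm_midpoint_le_one (hx n) (hx N))
    have h3 := hxm n
    have h4 := hxm N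
    have h5 : 1 / ((n : ℝ) + 1) ≤ 1 / ((N : ℝ) + 1) := by gcongr
    have h6 : r * μ / 8 * ‖x n - x N‖ ^ 2 < r * μ / 8 * δ ^ 2 := by
      rw [← hF] at h1
      linarith
    rw [dist_eq_norm]
    exact lt_of_pow_lt_pow_left₀ 2 hδ.le (lt_of_mul_lt_mul_left h6 (by positivity))
  obtain ⟨z, hz⟩ := cauchySeq_tendsto_of_complete hcauchy
  have hFc : Continuous F := by
    have : F = fun x => θ x + r * (1 / 2 * ‖x‖ ^ 2) := rfl
    rw [this]
    fun_prop
  have hzK : ‖z‖ ≤ 1 := le_of_tendsto' hz.norm hx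
  have hzm : F z ≤ m := by
    have h1 := (hFc.tendsto z).comp hz
    have h2 : Filter.Tendsto (fun n : ℕ => m + 1 / ((n : ℝ) + 1)) Filter.atTop (nhds (m + 0)) :=
      tendsto_const_nhds.add tendsto_one_div_add_atTop_nhds_zero_nat
    rw [add_zero] at h2
    exact le_of_tendsto_of_tendsto' h1 h2 fun n => (hxm n).le
  exact ⟨z, hzK, fun y hy => hzm.trans (hmle y hy)⟩

open Classical in
/-- A minimizer of the regularized objective on the unit ball (`0` if there is none). -/
def ftrlPoint {E : Type*} [NormedAddCommGroup E] [NormedSpace ℝ E]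
    (θ : StrongDual ℝ E) (r : ℝ) : E :=
  if h : ∃ x : E, ‖x‖ ≤ 1 ∧ ∀ y : E, ‖y‖ ≤ 1 → ftrlObjective θ r x ≤ ftrlObjective θ r y
  then h.choose else 0

theorem norm_ftrlPoint_le {E : Type*} [NormedAddCommGroup E] [NormedSpace ℝ E]
    (θ : StrongDual ℝ E) (r : ℝ) : ‖ftrlPoint θ r‖ ≤ 1 := by
  unfold ftrlPoint
  split_ifs with h
  · exact h.choose_spec.1
  · simp

theorem ftrlObjective_ftrlPoint_le {E : Type*} [NormedAddCommGroup E] [NormedSpace ℝ E]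
    [CompleteSpace E] {μ : ℝ} (hμ : 0 < μ) (hE : IsStronglyConvexSpace E μ)
    (θ : StrongDual ℝ E) {r : ℝ} (hr : 0 < r) {y : E} (hy : ‖y‖ ≤ 1) :
    ftrlObjective θ r (ftrlPoint θ r) ≤ ftrlObjective θ r y := by
  have h := exists_ftrl_minimizer hμ hE θ hr
  rw [ftrlPoint, dif_pos h]
  exact h.choose_spec.2 y hy

/-- Quadratic growth at the minimizer comes from comparing it with a midpoint. This costs a factor 2
in the constant but needs no optimality condition for the constrained problem. -/
theorem ftrlObjective_ftrlPoint_add_le {E : Type*} [NormedAddCommGroup E] [NormedSpace ℝ E]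
    [CompleteSpace E] {μ : ℝ} (hμ : 0 < μ) (hE : IsStronglyConvexSpace E μ)
    (θ : StrongDual ℝ E) {r : ℝ} (hr : 0 < r) {y : E} (hy : ‖y‖ ≤ 1) :
    ftrlObjective θ r (ftrlPoint θ r) + r * μ / 4 * ‖y - ftrlPoint θ r‖ ^ 2 ≤
      ftrlObjective θ r y := by
  have h1 := ftrlObjective_midpoint hE θ hr.le y (ftrlPoint θ r)
  have h2 := ftrlObjective_ftrlPoint_le hμ hE θ hr
    (norm_midpoint_le_one hy (norm_ftrlPoint_le θ r))
  linarith

/-- Follow-the-regularized-leader on the unit ball with adaptive regularization. -/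
def ballLearner (E : Type*) [NormedAddCommGroup E] [NormedSpace ℝ E] (μ : ℝ) :
    OnlineAlgorithm E :=
  fun _ c => ftrlPoint (∑ i, c i) (Real.sqrt ((1 + ∑ i, ‖c i‖ ^ 2) / μ))

theorem ballLearner_play {E : Type*} [NormedAddCommGroup E] [NormedSpace ℝ E] (μ : ℝ)
    (c : ℕ → StrongDual ℝ E) (t : ℕ) :
    (ballLearner E μ).play c t =
      ftrlPoint (∑ s ∈ range t, c s) (Real.sqrt ((1 + ∑ s ∈ range t, ‖c s‖ ^ 2) / μ)) := by
  simp only [OnlineAlgorithm.play, ballLearner, Finset.sum_range]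

theorem norm_ballLearner_play_le {E : Type*} [NormedAddCommGroup E] [NormedSpace ℝ E] (μ : ℝ)
    (c : ℕ → StrongDual ℝ E) (t : ℕ) : ‖(ballLearner E μ).play c t‖ ≤ 1 := by
  rw [ballLearner_play]
  exact norm_ftrlPoint_le _ _

/-- Makes the stability terms telescope although the regularizer omits the current cost: as `v ≤ 1 ≤
V`, one round cannot more than double `√V`. -/
theorem div_sqrt_le_sqrt_sub_sqrt {v V : ℝ} (hV : 1 ≤ V) (hv0 : 0 ≤ v) (hv1 : v ≤ 1) :
    v / Real.sqrt V ≤ 3 * (Real.sqrt (V + v) - Real.sqrt V) := by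
  have hpos : 0 < Real.sqrt V := Real.sqrt_pos.2 (by linarith)
  have h1 := Real.sq_sqrt (show 0 ≤ V by linarith)
  have h2 := Real.sq_sqrt (show 0 ≤ V + v by linarith)
  have h3 : Real.sqrt (V + v) ≤ 2 * Real.sqrt V := by
    rw [Real.sqrt_le_left (by positivity)]
    nlinarith
  have h4 : Real.sqrt V ≤ Real.sqrt (V + v) := Real.sqrt_le_sqrt (by linarith)
  rw [div_le_iff₀ hpos]
  nlinarith

theorem ballLearner_regret_le {E : Type*} [NormedAddCommGroup E] [NormedSpace ℝ E]
    [CompleteSpace E] {μ : ℝ} (hμ : 0 < μ) (hE : IsStronglyConvexSpace E μ)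
    (c : ℕ → StrongDual ℝ E) (hc : ∀ t, ‖c t‖ ≤ 1) (T : ℕ) {u : E} (hu : ‖u‖ ≤ 1) :
    (ballLearner E μ).regret c T u ≤ 4 * Real.sqrt ((1 + ∑ t ∈ range T, ‖c t‖ ^ 2) / μ) := by
  set V : ℕ → ℝ := fun t => 1 + ∑ s ∈ range t, ‖c s‖ ^ 2 with hV
  set r : ℕ → ℝ := fun t => Real.sqrt (V t / μ) with hr
  set θ : ℕ → StrongDual ℝ E := fun t => ∑ s ∈ range t, c s with hθ
  set d : ℕ → E := fun t => (ballLearner E μ).play c t with hd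
  have hdt : ∀ t, d t = ftrlPoint (θ t) (r t) := fun t => ballLearner_play μ c t
  have hV1 : ∀ t, 1 ≤ V t := fun t => by
    have : 0 ≤ ∑ s ∈ range t, ‖c s‖ ^ 2 := Finset.sum_nonneg fun _ _ => by positivity
    simp only [hV]
    linarith
  have hVs : ∀ t, V (t + 1) = V t + ‖c t‖ ^ 2 := fun t => by
    simp only [hV, Finset.sum_range_succ]
    ring
  have hrpos : ∀ t, 0 < r t := fun t => Real.sqrt_pos.2 (div_pos (by linarith [hV1 t]) hμ)
  have hrV : ∀ t, r t = Real.sqrt (V t) / Real.sqrt μ := fun t =>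
    Real.sqrt_div (by linarith [hV1 t]) μ
  have hdn : ∀ t, ‖d t‖ ≤ 1 := fun t => norm_ballLearner_play_le μ c t
  -- Be-the-leader induction: each round costs only the movement of the minimizer, which quadratic
  -- growth limits.
  have key : ∀ n, ∑ t ∈ range n, c t (d t) ≤
      ftrlObjective (θ n) (r n) (d n) + 3 * (r n - r 0) := by
    intro n
    induction n with
    | zero =>
      simp only [Finset.range_zero, Finset.sum_empty, sub_self, mul_zero, add_zero]
      have h0 : θ 0 = 0 := by simp [hθ]
      have := (hrpos 0).le
      rw [ftrlObjective, h0]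
      simp only [zero_apply, zero_add]
      positivity
    | succ n ih =>
      have h1 := ftrlObjective_ftrlPoint_add_le hμ hE (θ n) (hrpos n) (hdn (n + 1))
      rw [← hdt] at h1
      have hθs : θ (n + 1) (d (n + 1)) = θ n (d (n + 1)) + c n (d (n + 1)) := by
        simp [hθ, Finset.sum_range_succ]
      have hmono : r n ≤ r (n + 1) := by
        refine Real.sqrt_le_sqrt (div_le_div_of_nonneg_right ?_ hμ.le)
        rw [hVs]
        have := sq_nonneg ‖c n‖
        linarith
      have h2 : ftrlObjective (θ n) (r n) (d (n + 1)) + c n (d (n + 1)) ≤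
          ftrlObjective (θ (n + 1)) (r (n + 1)) (d (n + 1)) := by
        have := mul_le_mul_of_nonneg_right hmono
          (show 0 ≤ 1 / 2 * ‖d (n + 1)‖ ^ 2 by positivity)
        simp only [ftrlObjective, hθs]
        linarith
      have h3 : c n (d n) - c n (d (n + 1)) ≤ ‖c n‖ * ‖d (n + 1) - d n‖ := by
        rw [← map_sub, norm_sub_rev]
        exact (le_abs_self _).trans ((c n).le_opNorm _)
      -- Young's inequality, weighted so that the quadratic term is the growth term in `h1`.
      have h4 : ‖c n‖ * ‖d (n + 1) - d n‖ ≤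
          r n * μ / 4 * ‖d (n + 1) - d n‖ ^ 2 + ‖c n‖ ^ 2 / (r n * μ) := by
        have hp : 0 < r n * μ := mul_pos (hrpos n) hμ
        have : r n * μ / 4 * ‖d (n + 1) - d n‖ ^ 2 + ‖c n‖ ^ 2 / (r n * μ) -
            ‖c n‖ * ‖d (n + 1) - d n‖ =
            (r n * μ * ‖d (n + 1) - d n‖ / 2 - ‖c n‖) ^ 2 / (r n * μ) := by
          have := (hrpos n).ne'
          field_simp
          ring
        have h0 : 0 ≤ (r n * μ * ‖d (n + 1) - d n‖ / 2 - ‖c n‖) ^ 2 / (r n * μ) := by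
          positivity
        linarith
      have h5 : ‖c n‖ ^ 2 / (r n * μ) ≤ 3 * (r (n + 1) - r n) := by
        have hs : 0 < Real.sqrt μ := Real.sqrt_pos.2 hμ
        have hVp : 0 < Real.sqrt (V n) := Real.sqrt_pos.2 (by linarith [hV1 n])
        have h := div_sqrt_le_sqrt_sub_sqrt (hV1 n) (sq_nonneg ‖c n‖)
          (pow_le_one₀ (norm_nonneg _) (hc n))
        have e1 : ‖c n‖ ^ 2 / (r n * μ) = ‖c n‖ ^ 2 / Real.sqrt (V n) / Real.sqrt μ := by
          rw [hrV]
          nth_rewrite 2 [← Real.mul_self_sqrt hμ.le]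
          field_simp
        have e2 : 3 * (r (n + 1) - r n) =
            3 * (Real.sqrt (V n + ‖c n‖ ^ 2) - Real.sqrt (V n)) / Real.sqrt μ := by
          rw [hrV, hrV, hVs]
          ring
        rw [e1, e2]
        exact div_le_div_of_nonneg_right h hs.le
      rw [Finset.sum_range_succ]
      linarith
  have hfin := ftrlObjective_ftrlPoint_le hμ hE (θ T) (hrpos T) hu
  rw [← hdt] at hfin
  have hreg : (ballLearner E μ).regret c T u = ∑ t ∈ range T, c t (d t) - θ T u := by
    simp only [OnlineAlgorithm.regret, map_sub, Finset.sum_sub_distrib, hθ, hd]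
    simp
  have hu2 : r T * (1 / 2 * ‖u‖ ^ 2) ≤ r T * 1 := by
    refine mul_le_mul_of_nonneg_left ?_ (hrpos T).le
    nlinarith [norm_nonneg u]
  have := key T
  have h0 := (hrpos 0).le
  rw [hreg]
  simp only [ftrlObjective] at hfin this
  change _ ≤ 4 * r T
  linarith

/-! A one-dimensional coin bettor: a mixture of bettors with the constant betting fractions
`2⁻¹, 2⁻², …`. -/

/-- The betting fractions, which are also the weights of the mixture. -/
def betFraction (j : ℕ) : ℝ := (1 / 2) ^ (j + 1)

theorem betFraction_pos (j : ℕ) : 0 < betFraction j := by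
  unfold betFraction
  positivity

theorem betFraction_le_half (j : ℕ) : betFraction j ≤ 1 / 2 := by
  unfold betFraction
  rw [pow_succ]
  have : (1 / 2 : ℝ) ^ j ≤ 1 := pow_le_one₀ (by norm_num) (by norm_num)
  linarith

theorem hasSum_betFraction : HasSum betFraction 1 := by
  have h := hasSum_geometric_two.mul_right (1 / 2 : ℝ)
  have e : betFraction = fun j => (1 / 2 : ℝ) ^ j * (1 / 2) := by
    funext j
    rw [betFraction, pow_succ]
  rw [e]
  norm_num at h ⊢
  exact h

/-- The wealth of the bettor with fraction `β` and initial capital `1`. -/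
def betWealth (β : ℝ) (g : ℕ → ℝ) (t : ℕ) : ℝ := ∏ s ∈ range t, (1 - β * g s)

theorem betWealth_succ (β : ℝ) (g : ℕ → ℝ) (t : ℕ) :
    betWealth β g (t + 1) = betWealth β g t - betWealth β g t * β * g t := by
  rw [betWealth, Finset.prod_range_succ, ← betWealth]
  ring

theorem half_le_one_sub_betFraction_mul {g : ℝ} (hg : |g| ≤ 1) (j : ℕ) :
    1 / 2 ≤ 1 - betFraction j * g := by
  have h1 := betFraction_pos j
  have h2 := betFraction_le_half j
  have h3 := (abs_le.1 hg).2
  nlinarith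

theorem betWealth_nonneg {g : ℕ → ℝ} (hg : ∀ t, |g t| ≤ 1) (j t : ℕ) :
    0 ≤ betWealth (betFraction j) g t :=
  Finset.prod_nonneg fun s _ => by linarith [half_le_one_sub_betFraction_mul (hg s) j]

theorem betWealth_le {g : ℕ → ℝ} (hg : ∀ t, |g t| ≤ 1) (j t : ℕ) :
    betWealth (betFraction j) g t ≤ 2 ^ t := by
  have h : betWealth (betFraction j) g t ≤ ∏ _s ∈ range t, (2 : ℝ) := by
    refine Finset.prod_le_prod
      (fun s _ => by linarith [half_le_one_sub_betFraction_mul (hg s) j]) fun s _ => ?_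
    have h1 := betFraction_pos j
    have h2 := betFraction_le_half j
    have h3 := (abs_le.1 (hg s)).1
    nlinarith
  simpa using h

theorem summable_betFraction_mul_betWealth {g : ℕ → ℝ} (hg : ∀ t, |g t| ≤ 1) (t : ℕ) :
    Summable fun j => betFraction j * betWealth (betFraction j) g t :=
  Summable.of_nonneg_of_le
    (fun j => mul_nonneg (betFraction_pos j).le (betWealth_nonneg hg j t))
    (fun j => mul_le_mul_of_nonneg_left (betWealth_le hg j t) (betFraction_pos j).le)
    (hasSum_betFraction.summable.mul_right (2 ^ t))

theorem summable_betFraction_mul_betWealth_mul {g : ℕ → ℝ} (hg : ∀ t, |g t| ≤ 1) (t : ℕ) :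
    Summable fun j => betFraction j * betWealth (betFraction j) g t * betFraction j :=
  Summable.of_nonneg_of_le
    (fun j => mul_nonneg (mul_nonneg (betFraction_pos j).le (betWealth_nonneg hg j t))
      (betFraction_pos j).le)
    (fun j => mul_le_of_le_one_right
      (mul_nonneg (betFraction_pos j).le (betWealth_nonneg hg j t))
      ((betFraction_le_half j).trans (by norm_num)))
    (summable_betFraction_mul_betWealth hg t)

/-- The wealth of the mixture with initial capital `1`. -/
def mixtureWealth (g : ℕ → ℝ) (t : ℕ) : ℝ :=
  ∑' j, betFraction j * betWealth (betFraction j) g t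

/-- The bet of the mixture with initial capital `1`. -/
def mixtureBet (g : ℕ → ℝ) (t : ℕ) : ℝ :=
  ∑' j, betFraction j * betWealth (betFraction j) g t * betFraction j

theorem mixtureWealth_zero (g : ℕ → ℝ) : mixtureWealth g 0 = 1 := by
  simpa [mixtureWealth, betWealth] using hasSum_betFraction.tsum_eq

theorem mixtureWealth_succ {g : ℕ → ℝ} (hg : ∀ t, |g t| ≤ 1) (t : ℕ) :
    mixtureWealth g (t + 1) = mixtureWealth g t - mixtureBet g t * g t := by
  have h := (summable_betFraction_mul_betWealth hg t).hasSum.sub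
    ((summable_betFraction_mul_betWealth_mul hg t).hasSum.mul_right (g t))
  have e : (fun j => betFraction j * betWealth (betFraction j) g (t + 1)) = fun j =>
      betFraction j * betWealth (betFraction j) g t -
        betFraction j * betWealth (betFraction j) g t * betFraction j * g t := by
    funext j
    rw [betWealth_succ]
    ring
  rw [mixtureWealth, e]
  exact h.tsum_eq

/-- The losses telescope to minus the change in wealth, so nonnegative wealth caps the total loss at
the initial capital. -/
theorem sum_mixtureBet_mul {g : ℕ → ℝ} (hg : ∀ t, |g t| ≤ 1) (T : ℕ) :
    ∑ t ∈ range T, mixtureBet g t * g t = 1 - mixtureWealth g T := by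
  induction T with
  | zero => simp [mixtureWealth_zero]
  | succ n ih =>
    rw [Finset.sum_range_succ, ih, mixtureWealth_succ hg]
    ring

theorem mixtureWealth_nonneg {g : ℕ → ℝ} (hg : ∀ t, |g t| ≤ 1) (T : ℕ) :
    0 ≤ mixtureWealth g T :=
  tsum_nonneg fun j => mul_nonneg (betFraction_pos j).le (betWealth_nonneg hg j T)

/-- Turns the wealth product into an exponential of sums. Costs of either sign occur, so negative
`x` is needed too. -/
theorem exp_neg_sub_sq_le {x : ℝ} (hx : x ≤ 1 / 2) : Real.exp (-x - x ^ 2) ≤ 1 - x := by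
  suffices h : 1 ≤ (1 - x) * Real.exp (x + x ^ 2) by
    rw [show -x - x ^ 2 = -(x + x ^ 2) by ring, Real.exp_neg, inv_le_iff_one_le_mul₀ (Real.exp_pos _)]
    exact h
  rcases le_total 0 x with h0 | h0
  · have h := Real.quadratic_le_exp_of_nonneg (show 0 ≤ x + x ^ 2 by positivity)
    refine le_trans ?_ (mul_le_mul_of_nonneg_left h (show 0 ≤ 1 - x by linarith))
    have h1 : 0 ≤ (1 - x) * (1 + x) ^ 2 / 2 - x := by
      nlinarith [mul_nonneg h0 (sub_nonneg.2 hx), mul_nonneg (mul_nonneg h0 h0) (sub_nonneg.2 hx)]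
    nlinarith [mul_nonneg (sq_nonneg x) h1]
  · refine le_trans ?_ (mul_le_mul_of_nonneg_left (Real.add_one_le_exp (x + x ^ 2))
      (show 0 ≤ 1 - x by linarith))
    nlinarith [mul_nonneg (sq_nonneg x) (neg_nonneg.2 h0)]

/-- All bettors have nonnegative wealth, so the mixture is worth at least the share of any single
one. -/
theorem mixtureWealth_ge {g : ℕ → ℝ} (hg : ∀ t, |g t| ≤ 1) (T j : ℕ) :
    betFraction j * Real.exp (-(betFraction j * ∑ t ∈ range T, g t) -
      betFraction j ^ 2 * ∑ t ∈ range T, g t ^ 2) ≤ mixtureWealth g T := by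
  have h1 : Real.exp (-(betFraction j * ∑ t ∈ range T, g t) -
      betFraction j ^ 2 * ∑ t ∈ range T, g t ^ 2) ≤ betWealth (betFraction j) g T := by
    have e : -(betFraction j * ∑ t ∈ range T, g t) - betFraction j ^ 2 * ∑ t ∈ range T, g t ^ 2 =
        ∑ t ∈ range T, (-(betFraction j * g t) - (betFraction j * g t) ^ 2) := by
      simp only [Finset.sum_sub_distrib, Finset.sum_neg_distrib, Finset.mul_sum, mul_pow]
    rw [e, Real.exp_sum]
    refine Finset.prod_le_prod (fun _ _ => (Real.exp_pos _).le) fun t _ => exp_neg_sub_sq_le ?_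
    linarith [half_le_one_sub_betFraction_mul (hg t) j]
  refine (mul_le_mul_of_nonneg_left h1 (betFraction_pos j).le).trans ?_
  exact (summable_betFraction_mul_betWealth hg T).le_tsum j
    fun i _ => mul_nonneg (betFraction_pos i).le (betWealth_nonneg hg i T)

theorem exists_betFraction_mem {s : ℝ} (hs : 1 ≤ s) :
    ∃ j, 1 / (4 * s) ≤ betFraction j ∧ betFraction j ≤ 1 / (2 * s) := by
  obtain ⟨n, h1, h2⟩ := exists_nat_pow_near hs (show (1 : ℝ) < 2 by norm_num)
  -- Here `2 ^ n ≤ s < 2 ^ (n + 1)`, and the chosen fraction is `2 ^ -(n + 2)`.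
  refine ⟨n + 1, ?_, ?_⟩
  · rw [betFraction, one_div_pow]
    refine one_div_le_one_div_of_le (by positivity) ?_
    rw [pow_succ, pow_succ]
    linarith
  · rw [betFraction, one_div_pow]
    refine one_div_le_one_div_of_le (by positivity) ?_
    rw [pow_succ]
    linarith

theorem one_le_logFactor {r ε : ℝ} (T : ℕ) (hr : 0 ≤ r) (hε : 0 < ε) : 1 ≤ logFactor T r ε := by
  rw [logFactor, Real.le_log_iff_exp_le (by positivity)]
  have : 0 ≤ r / ε := by positivity
  have : (0 : ℝ) ≤ T := by positivity
  linarith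

theorem logFactor_mono {r r' ε : ℝ} (T : ℕ) (hr : 0 ≤ r) (h : r ≤ r') (hε : 0 < ε) :
    logFactor T r ε ≤ logFactor T r' ε := by
  refine Real.log_le_log (by positivity) ?_
  gcongr

/-- The capital grows so fast in the sum of the costs that the regret stays small. -/
theorem mul_sub_mixtureWealth_le {g : ℕ → ℝ} (hg : ∀ t, |g t| ≤ 1) (T : ℕ) {r ε : ℝ}
    (hr : 0 ≤ r) (hε : 0 < ε) :
    r * (-∑ t ∈ range T, g t) - ε * mixtureWealth g T ≤
      48 * logFactor T r ε * (r * Real.sqrt (1 + ∑ t ∈ range T, g t ^ 2)) := by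
  set G : ℝ := ∑ t ∈ range T, g t ^ 2 with hG
  set Θ : ℝ := -∑ t ∈ range T, g t with hΘ
  set s : ℝ := Real.sqrt (1 + G) with hs
  set L : ℝ := Real.exp 1 + T + r / ε with hL
  have hG0 : 0 ≤ G := Finset.sum_nonneg fun _ _ => sq_nonneg _
  have hGT : G ≤ T := by
    have h : G ≤ ∑ _t ∈ range T, (1 : ℝ) :=
      Finset.sum_le_sum fun t _ => (sq_le_one_iff_abs_le_one _).2 (hg t)
    simpa using h
  have hs1 : 1 ≤ s := Real.one_le_sqrt.2 (by linarith)
  have hs2 : s ^ 2 = 1 + G := Real.sq_sqrt (by linarith)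
  have hW := mixtureWealth_nonneg hg T
  have hlog := one_le_logFactor T hr hε
  -- For small `Θ` the right side already covers `r * Θ`. Otherwise the wealth alone pays for it.
  by_cases hcase : Θ ≤ 48 * logFactor T r ε * s
  · have := mul_le_mul_of_nonneg_left hcase hr
    have := mul_nonneg hε.le hW
    linarith
  push Not at hcase
  set X : ℝ := Θ / s with hX
  have hΘX : Θ = X * s := by rw [hX]; field_simp
  have hXlog : 48 * logFactor T r ε ≤ X := by
    rw [hX, le_div_iff₀ (by linarith)]
    exact hcase.le
  have hX0 : 0 ≤ X := by linarith
  obtain ⟨j, hj1, hj2⟩ := exists_betFraction_mem hs1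
  have hβ := betFraction_pos j
  -- The lower bound on the fraction gives the gain `X / 4`; the upper bound keeps the quadratic
  -- penalty below `1 / 4`.
  have hexp : X / 4 - 1 / 4 ≤ -(betFraction j * ∑ t ∈ range T, g t) - betFraction j ^ 2 * G := by
    have h1 : X / 4 ≤ betFraction j * Θ := by
      have := mul_le_mul_of_nonneg_right hj1 (show 0 ≤ Θ by rw [hΘX]; positivity)
      refine le_trans (le_of_eq ?_) this
      rw [hX]
      field_simp
    have h2 : betFraction j ^ 2 * G ≤ 1 / 4 := by
      have h3 : betFraction j * s ≤ 1 / 2 := by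
        rw [le_div_iff₀ (by positivity)] at hj2
        linarith
      have h4 : (betFraction j * s) ^ 2 ≤ (1 / 2) ^ 2 := by gcongr
      rw [mul_pow, hs2] at h4
      nlinarith [sq_nonneg (betFraction j)]
    have h3 : -(betFraction j * ∑ t ∈ range T, g t) = betFraction j * Θ := by
      rw [hΘ]
      ring
    linarith
  have hwealth : 1 / (4 * s) * Real.exp (X / 4 - 1 / 4) ≤ mixtureWealth g T :=
    (mul_le_mul hj1 (Real.exp_le_exp.2 hexp) (Real.exp_pos _).le hβ.le).trans
      (mixtureWealth_ge hg T j)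
  have hLe : Real.exp 1 ≤ L := by
    have : 0 ≤ r / ε := by positivity
    have : (0 : ℝ) ≤ T := by positivity
    linarith
  have he : (2.7 : ℝ) < Real.exp 1 := by linarith [Real.exp_one_gt_d9]
  have hLpos : 0 < L := by linarith
  have hlogL : logFactor T r ε = Real.log L := rfl
  -- This is where 48 = 8 · 6 comes from: two powers of `L` absorb `r / ε * (1 + G)`, four absorb
  -- numerical constants, and the other half of `exp (X / 4)` absorbs `X`.
  have hX6 : L ^ 6 ≤ Real.exp (X / 8) := by
    rw [← Real.exp_log (pow_pos hLpos 6), Real.exp_le_exp, Real.log_pow, ← hlogL]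
    push_cast
    linarith
  have hX8 : X / 8 ≤ Real.exp (X / 8) := by linarith [Real.add_one_le_exp (X / 8)]
  have hL4 : 50 ≤ L ^ 4 := by
    have h : (2.7 : ℝ) ^ 4 ≤ L ^ 4 := by
      gcongr
      linarith
    norm_num at h
    linarith
  have hrL : r / ε * (1 + G) ≤ L ^ 2 := by
    have h1 : r / ε ≤ L := by
      have : (0 : ℝ) ≤ T := by positivity
      linarith
    have h2 : 1 + G ≤ L := by
      have : 0 ≤ r / ε := by positivity
      linarith
    rw [sq]
    exact mul_le_mul h1 h2 (by linarith) hLpos.le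
  have hquarter : Real.exp (X / 4) ≤ 3 / 2 * Real.exp (X / 4 - 1 / 4) := by
    have h := mul_le_mul_of_nonneg_left (Real.add_one_le_exp (-(1 / 4) : ℝ))
      (Real.exp_pos (X / 4)).le
    rw [← Real.exp_add, show X / 4 + -(1 / 4) = X / 4 - 1 / 4 by ring] at h
    linarith [Real.exp_pos (X / 4)]
  have hmain : r / ε * (X * s) ≤ mixtureWealth g T := by
    refine le_trans ?_ hwealth
    have h1 : 48 * (r / ε * (1 + G)) * (X / 8) ≤ L ^ 6 * Real.exp (X / 8) := by
      refine mul_le_mul ?_ hX8 (by linarith) (by positivity)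
      have := mul_le_mul hL4 hrL (by positivity) (by positivity)
      nlinarith [sq_nonneg L]
    have h2 : L ^ 6 * Real.exp (X / 8) ≤ Real.exp (X / 4) := by
      have := mul_le_mul_of_nonneg_right hX6 (Real.exp_pos (X / 8)).le
      rwa [← Real.exp_add, show X / 8 + X / 8 = X / 4 by ring] at this
    have h3 : 4 * s * (r / ε * (X * s)) ≤ Real.exp (X / 4 - 1 / 4) := by
      have : 4 * s * (r / ε * (X * s)) = 4 * (r / ε * (1 + G)) * X := by
        rw [← hs2]
        ring
      rw [this]
      linarith
    rw [one_div_mul_eq_div, le_div_iff₀ (by positivity)]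
    linarith
  have hfinal : r * Θ ≤ ε * mixtureWealth g T := by
    have := mul_le_mul_of_nonneg_left hmain hε.le
    refine le_trans (le_of_eq ?_) this
    rw [hΘX]
    field_simp
  have : 0 ≤ 48 * logFactor T r ε * (r * s) := by positivity
  linarith

/-! The learner on `E`: a one-dimensional bettor chooses the length, follow-the-regularized-leader
on the unit ball chooses the direction. -/

/-- The parameter-free learner with initial capital `ε`. -/
def parameterFreeLearner (E : Type*) [NormedAddCommGroup E] [NormedSpace ℝ E] (μ ε : ℝ) :
    OnlineAlgorithm E :=
  fun t c =>
    -- The wealth is recomputed from the past by replaying the ball learner on every prefix.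
    (ε * ∑' j, betFraction j *
      (∏ s : Fin t, (1 - betFraction j *
        c s (ballLearner E μ s fun i => c (i.castLE s.isLt.le)))) * betFraction j) •
      ballLearner E μ t c

theorem parameterFreeLearner_play {E : Type*} [NormedAddCommGroup E] [NormedSpace ℝ E] (μ ε : ℝ)
    (c : ℕ → StrongDual ℝ E) (t : ℕ) :
    (parameterFreeLearner E μ ε).play c t =
      (ε * mixtureBet (fun s => c s ((ballLearner E μ).play c s)) t) •
        (ballLearner E μ).play c t := by
  simp only [OnlineAlgorithm.play, parameterFreeLearner, mixtureBet, betWealth,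
    Finset.prod_range, Fin.val_castLE]

theorem isParameterFree_parameterFreeLearner {E : Type*} [NormedAddCommGroup E] [NormedSpace ℝ E]
    [CompleteSpace E] {μ ε : ℝ} (hμ : 0 < μ) (hε : 0 < ε) (hE : IsStronglyConvexSpace E μ) :
    IsParameterFree (parameterFreeLearner E μ ε) μ ε 52 1 := by
  intro c hc T
  set d : ℕ → E := fun t => (ballLearner E μ).play c t with hd
  set g : ℕ → ℝ := fun t => c t (d t) with hgdef
  have hgc : ∀ t, |g t| ≤ ‖c t‖ := fun t => by
    have h := (c t).le_opNorm_of_le (norm_ballLearner_play_le μ c t)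
    rwa [mul_one] at h
  have hg : ∀ t, |g t| ≤ 1 := fun t => (hgc t).trans (hc t)
  have hloss : ∑ t ∈ range T, c t ((parameterFreeLearner E μ ε).play c t) =
      ε - ε * mixtureWealth g T := by
    have h : ∀ t, c t ((parameterFreeLearner E μ ε).play c t) = ε * (mixtureBet g t * g t) :=
      fun t => by
        rw [parameterFreeLearner_play, map_smul, smul_eq_mul, mul_assoc]
    simp only [h]
    rw [← Finset.mul_sum, sum_mixtureBet_mul hg]
    ring
  have hW := mul_nonneg hε.le (mixtureWealth_nonneg hg T)
  have hzero : (parameterFreeLearner E μ ε).regret c T 0 ≤ ε := by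
    simp only [OnlineAlgorithm.regret, sub_zero, hloss]
    linarith
  refine ⟨hzero, fun u => ?_⟩
  set V : ℝ := ∑ t ∈ range T, ‖c t‖ ^ 2 with hV
  have hlog := one_le_logFactor T (norm_nonneg u) hε
  rw [pow_one]
  rcases eq_or_ne u 0 with rfl | hu
  · refine hzero.trans ?_
    rw [norm_zero, zero_mul, add_zero]
    rw [norm_zero] at hlog
    nlinarith
  have hupos : 0 < ‖u‖ := norm_pos_iff.2 hu
  have hV0 : 0 ≤ V := Finset.sum_nonneg fun _ _ => by positivity
  have hball := ballLearner_regret_le hμ hE c hc T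
    (show ‖‖u‖⁻¹ • u‖ ≤ 1 by rw [norm_smul, norm_inv, norm_norm, inv_mul_cancel₀ hupos.ne'])
  have hbet := mul_sub_mixtureWealth_le hg T hupos.le hε
  have hGV : ∑ t ∈ range T, g t ^ 2 ≤ V := Finset.sum_le_sum fun t _ => by
    rw [← sq_abs]
    exact pow_le_pow_left₀ (abs_nonneg _) (hgc t) 2
  set S : ℝ := Real.sqrt ((1 + V) / μ) with hS
  -- The scalar bound has no `μ`; it fits under the bound on `E` because `μ ≤ 1`.
  have hsqrt : Real.sqrt (1 + ∑ t ∈ range T, g t ^ 2) ≤ S := by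
    refine Real.sqrt_le_sqrt ?_
    rw [le_div_iff₀ hμ]
    have h1 := hE.le_one hu
    have h2 : 0 ≤ ∑ t ∈ range T, g t ^ 2 := Finset.sum_nonneg fun _ _ => sq_nonneg _
    nlinarith
  -- Inserting `‖u‖ * ∑ g t` separates the error in length from the error in direction. The
  -- constants 48 and 4 then add up to 52.
  have hreg : (parameterFreeLearner E μ ε).regret c T u =
      ε + (‖u‖ * (-∑ t ∈ range T, g t) - ε * mixtureWealth g T) +
        ‖u‖ * (ballLearner E μ).regret c T (‖u‖⁻¹ • u) := by
    simp only [OnlineAlgorithm.regret, map_sub, Finset.sum_sub_distrib, hloss, map_smul,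
      smul_eq_mul, ← Finset.mul_sum]
    change _ = ε + (‖u‖ * (-∑ t ∈ range T, g t) - ε * mixtureWealth g T) +
      ‖u‖ * (∑ t ∈ range T, g t - _)
    field_simp
    ring
  have h1 := mul_le_mul_of_nonneg_left hball hupos.le
  have h2 : 48 * logFactor T ‖u‖ ε * (‖u‖ * Real.sqrt (1 + ∑ t ∈ range T, g t ^ 2)) ≤
      48 * logFactor T ‖u‖ ε * (‖u‖ * S) := by gcongr
  have h3 : 0 ≤ ‖u‖ * S := mul_nonneg hupos.le (Real.sqrt_nonneg _)
  rw [hreg]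
  nlinarith [mul_nonneg (sub_nonneg.2 hlog) h3, mul_nonneg (sub_nonneg.2 hlog) hε.le]

/-! Combining the two learners. -/

/-- The costs that are fed to the one-dimensional learner. -/
def hintCosts {E : Type*} [NormedAddCommGroup E] [NormedSpace ℝ E]
    (c : ℕ → StrongDual ℝ E) (h : ℕ → E) (t : ℕ) : StrongDual ℝ ℝ :=
  (-(c t (h t))) • ContinuousLinearMap.id ℝ ℝ

theorem hintCosts_apply {E : Type*} [NormedAddCommGroup E] [NormedSpace ℝ E]
    (c : ℕ → StrongDual ℝ E) (h : ℕ → E) (t : ℕ) (y : ℝ) :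
    hintCosts c h t y = -(c t (h t)) * y := rfl

theorem norm_hintCosts_le {E : Type*} [NormedAddCommGroup E] [NormedSpace ℝ E]
    (c : ℕ → StrongDual ℝ E) {h : ℕ → E} (hh : ∀ t, ‖h t‖ ≤ 1) (t : ℕ) :
    ‖hintCosts c h t‖ ≤ ‖c t‖ := by
  have h1 := (c t).le_opNorm_of_le (hh t)
  rw [mul_one] at h1
  rw [hintCosts, norm_smul, norm_neg]
  exact (mul_le_of_le_one_right (norm_nonneg _) ContinuousLinearMap.norm_id_le).trans h1

/-- The regret of the sum of two learners splits for every scalar comparator `y`. -/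
theorem addLearners_regret {E : Type*} [NormedAddCommGroup E] [NormedSpace ℝ E]
    (A : OnlineAlgorithm E) (A₁ : OnlineAlgorithm ℝ) (c : ℕ → StrongDual ℝ E) (h : ℕ → E)
    (T : ℕ) (u : E) (y : ℝ) :
    (addLearners A A₁).regret c h T u =
      A.regret c T u + A₁.regret (hintCosts c h) T y - y * ∑ t ∈ range T, c t (h t) := by
  have hplay : ∀ t, (addLearners A A₁).play c h t =
      A.play c t - A₁.play (hintCosts c h) t • h t := fun t => rfl
  simp only [HintAlgorithm.regret, OnlineAlgorithm.regret, Finset.mul_sum]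
  rw [← Finset.sum_add_distrib, ← Finset.sum_sub_distrib]
  refine Finset.sum_congr rfl fun t _ => ?_
  rw [hplay, hintCosts_apply, map_sub, map_sub, map_sub, map_smul, smul_eq_mul]
  ring

theorem sum_hint_ge {E : Type*} [NormedAddCommGroup E] [NormedSpace ℝ E]
    {c : ℕ → StrongDual ℝ E} {h : ℕ → E} (hc : ∀ t, ‖c t‖ ≤ 1) (hh : ∀ t, ‖h t‖ ≤ 1)
    {T : ℕ} {α : ℝ} {S : Finset ℕ} (hS : S ⊆ range T) (hcor : CorrelatedOutside c h T α S) :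
    α * ∑ t ∈ range T \ S, ‖c t‖ ^ 2 - S.card ≤ ∑ t ∈ range T, c t (h t) := by
  rw [← Finset.sum_sdiff hS]
  have h1 : ∑ _t ∈ S, (-1 : ℝ) ≤ ∑ t ∈ S, c t (h t) := Finset.sum_le_sum fun t _ => by
    have h2 := (c t).le_of_opNorm_le_of_le (hc t) (hh t)
    rw [mul_one] at h2
    exact (abs_le.1 h2).1
  rw [Finset.sum_const, nsmul_eq_mul] at h1
  have := hcor
  unfold CorrelatedOutside at this
  linarith

theorem sum_norm_sq_le {E : Type*} [NormedAddCommGroup E] [NormedSpace ℝ E]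
    {c : ℕ → StrongDual ℝ E} (hc : ∀ t, ‖c t‖ ≤ 1) {T : ℕ} {S : Finset ℕ} (hS : S ⊆ range T) :
    ∑ t ∈ range T, ‖c t‖ ^ 2 ≤ ∑ t ∈ range T \ S, ‖c t‖ ^ 2 + S.card := by
  rw [← Finset.sum_sdiff hS]
  have h1 : ∑ t ∈ S, ‖c t‖ ^ 2 ≤ ∑ _t ∈ S, (1 : ℝ) :=
    Finset.sum_le_sum fun t _ => pow_le_one₀ (norm_nonneg _) (hc t)
  rw [Finset.sum_const, nsmul_eq_mul] at h1
  linarith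

/-- Trading the regret `D a √((1 + V) / μ)` of the two learners against the gain `y α V` from the
hints. -/
theorem hint_tradeoff {a b V W α μ D : ℝ} (ha : 0 < a) (hb : 0 ≤ b) (hV : 0 ≤ V) (hW : W ≤ V + b)
    (hα : 0 < α) (hμ : 0 < μ) (hμ1 : μ ≤ 1) (hD : 1 ≤ D) :
    2 * D * (a * Real.sqrt ((1 + W) / μ)) -
        a / max 1 (α * Real.sqrt (1 + b)) * (α * V - b) ≤
      5 * D ^ 2 * (a * (1 + Real.sqrt b) / (min α 1 * μ)) := by
  set M : ℝ := max 1 (α * Real.sqrt (1 + b)) with hM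
  set q : ℝ := (1 + Real.sqrt b) / (min α 1 * μ) with hq
  have hM1 : 1 ≤ M := le_max_left _ _
  have hM2 : α * Real.sqrt (1 + b) ≤ M := le_max_right _ _
  have hMpos : 0 < M := by linarith
  have hsb := Real.sqrt_nonneg b
  have hmin : 0 < min α 1 := lt_min hα one_pos
  have hmin1 : min α 1 ≤ 1 := min_le_right _ _
  have hminα : min α 1 ≤ α := min_le_left _ _
  have hq0 : 0 ≤ q := by positivity
  have hsqrt1b : Real.sqrt (1 + b) ≤ 1 + Real.sqrt b := by
    rw [Real.sqrt_le_left (by positivity)]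
    nlinarith [Real.sq_sqrt hb]
  have hμs : 1 / Real.sqrt μ ≤ 1 / μ := by
    refine one_div_le_one_div_of_le hμ (Real.le_sqrt_of_sq_le ?_)
    nlinarith
  -- the regret that does not come from the good rounds
  have h1 : Real.sqrt ((1 + b) / μ) ≤ q := by
    rw [Real.sqrt_div (by linarith), div_eq_mul_one_div]
    refine (mul_le_mul hsqrt1b hμs (by positivity) (by positivity)).trans ?_
    rw [← div_eq_mul_one_div, hq]
    refine div_le_div_of_nonneg_left (by positivity) (by positivity) ?_
    nlinarith
  have hsplit : Real.sqrt ((1 + W) / μ) ≤ Real.sqrt ((1 + b) / μ) + Real.sqrt (V / μ) := by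
    have hle : (1 + W) / μ ≤ (1 + b) / μ + V / μ := by
      rw [← add_div]
      exact div_le_div_of_nonneg_right (by linarith) hμ.le
    have hs1 : 0 ≤ (1 + b) / μ := by positivity
    have hs2 : 0 ≤ V / μ := by positivity
    rw [Real.sqrt_le_left (by positivity)]
    nlinarith [Real.sq_sqrt hs1, Real.sq_sqrt hs2,
      mul_nonneg (Real.sqrt_nonneg ((1 + b) / μ)) (Real.sqrt_nonneg (V / μ))]
  -- the price of the bad rounds
  have h2 : b / M ≤ q := by
    have h3 : b / M ≤ Real.sqrt b / α := by
      rw [div_le_div_iff₀ hMpos hα]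
      have h4 : Real.sqrt b ≤ Real.sqrt (1 + b) := Real.sqrt_le_sqrt (by linarith)
      have h5 := Real.mul_self_sqrt hb
      calc b * α = Real.sqrt b * (α * Real.sqrt b) := by linear_combination -α * h5
        _ ≤ Real.sqrt b * M := by
          refine mul_le_mul_of_nonneg_left (le_trans ?_ hM2) hsb
          exact mul_le_mul_of_nonneg_left h4 hα.le
    refine h3.trans (div_le_div₀ (by positivity) (by linarith) (by positivity) ?_)
    nlinarith
  -- the gain from the good rounds
  have h3 : M / (α * μ) ≤ 2 * q := by
    have e : 2 * q = 2 * (1 + Real.sqrt b) / (min α 1 * μ) := by rw [hq]; ring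
    rw [e, div_le_div_iff₀ (by positivity) (by positivity)]
    have h4 : M * min α 1 ≤ 2 * (1 + Real.sqrt b) * α := by
      rcases max_choice 1 (α * Real.sqrt (1 + b)) with h | h
      · rw [hM, h]
        nlinarith
      · rw [hM, h]
        have : α * Real.sqrt (1 + b) * min α 1 ≤ α * (1 + Real.sqrt b) * 1 := by gcongr
        nlinarith
    nlinarith
  -- Completing the square in `√(V / μ)`: the linear gain beats the square-root regret, whatever `V`
  -- is.
  have h4 : 2 * D * Real.sqrt (V / μ) - α * V / M ≤ D ^ 2 * (M / (α * μ)) := by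
    set w := Real.sqrt (V / μ) with hw
    have hVw : V = μ * w ^ 2 := by
      rw [hw, Real.sq_sqrt (by positivity)]
      field_simp
    have e : D ^ 2 * (M / (α * μ)) - (2 * D * w - α * V / M) =
        (D * M - α * μ * w) ^ 2 / (α * μ * M) := by
      rw [hVw]
      field_simp
      ring
    have : 0 ≤ (D * M - α * μ * w) ^ 2 / (α * μ * M) := by positivity
    linarith
  have h5 : 2 * D * Real.sqrt ((1 + W) / μ) - 1 / M * (α * V - b) ≤ 5 * D ^ 2 * q := by
    have e : 1 / M * (α * V - b) = α * V / M - b / M := by ring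
    have h6 := mul_le_mul_of_nonneg_left hsplit (show 0 ≤ 2 * D by linarith)
    have h7 := mul_le_mul_of_nonneg_left h1 (show 0 ≤ 2 * D by linarith)
    have h8 := mul_le_mul_of_nonneg_left h3 (sq_nonneg D)
    have h9 : D * q ≤ D ^ 2 * q := mul_le_mul_of_nonneg_right (by nlinarith) hq0
    have h10 : q ≤ D * q := le_mul_of_one_le_left hq0 hD
    rw [e]
    linarith
  have h6 := mul_le_mul_of_nonneg_left h5 ha.le
  have e1 : a * (1 + Real.sqrt b) / (min α 1 * μ) = a * q := by rw [hq]; ring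
  have e2 : a / M = a * (1 / M) := by ring
  rw [e1, e2]
  linarith

/-- The learners satisfy a sharper bound than the combined one; this lets all three share one `C`
and one `k`. -/
theorem IsParameterFree.mono {E : Type*} [NormedAddCommGroup E] [NormedSpace ℝ E]
    {A : OnlineAlgorithm E} {μ ε C C' : ℝ} {k k' : ℕ} (hA : IsParameterFree A μ ε C k)
    (hε : 0 < ε) (hC : 0 ≤ C) (hCC : C ≤ C') (hk : k ≤ k') : IsParameterFree A μ ε C' k' := by
  intro c hc T
  refine ⟨(hA c hc T).1, fun u => ((hA c hc T).2 u).trans ?_⟩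
  have hlog := one_le_logFactor T (norm_nonneg u) hε
  have := pow_le_pow_right₀ hlog hk
  gcongr
  exact hC.trans hCC

/-- Adding two parameter-free learners makes use of the hints. -/
theorem addLearners_regret_le {E : Type*} [NormedAddCommGroup E] [NormedSpace ℝ E]
    {A : OnlineAlgorithm E} {A₁ : OnlineAlgorithm ℝ} {μ ε C : ℝ} (hμ : 0 < μ) (hε : 0 < ε)
    (hC : 1 ≤ C) (hE : IsStronglyConvexSpace E μ) (hA : IsParameterFree A μ ε C 1)
    (hA₁ : IsParameterFree A₁ 1 ε C 1) {c : ℕ → StrongDual ℝ E} {h : ℕ → E}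
    (hc : ∀ t, ‖c t‖ ≤ 1) (hh : ∀ t, ‖h t‖ ≤ 1) (T : ℕ) {α : ℝ} (hα : 0 < α) (u : E) :
    (addLearners A A₁).regret c h T u ≤
      10 * C ^ 2 * logFactor T ‖u‖ ε ^ 2 *
        (ε + ‖u‖ * Real.log (1 + T * ‖u‖ / min ε (ε ^ 2)) *
            (1 + Real.sqrt (badCount c h T α)) / (min α 1 * μ)) := by
  set b : ℝ := (badCount c h T α : ℝ) with hb
  set m : ℝ := min ε (ε ^ 2) with hm
  set Λ : ℝ := logFactor T ‖u‖ ε with hΛ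
  have hΛ1 : 1 ≤ Λ := one_le_logFactor T (norm_nonneg u) hε
  have hmpos : 0 < m := lt_min hε (by positivity)
  have hmε : m ≤ ε := min_le_left _ _
  have hb0 : 0 ≤ b := Nat.cast_nonneg _
  have hD : 1 ≤ C * Λ := one_le_mul_of_one_le_of_one_le hC hΛ1
  have hD2 : 1 ≤ (C * Λ) ^ 2 := one_le_pow₀ hD
  have hcost : ∀ t, ‖hintCosts c h t‖ ≤ 1 := fun t => (norm_hintCosts_le c hh t).trans (hc t)
  have hmin : 0 < min α 1 := lt_min hα one_pos
  have hlog0 : 0 ≤ Real.log (1 + T * ‖u‖ / m) :=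
    Real.log_nonneg (le_add_of_nonneg_right (by positivity))
  rw [show 10 * C ^ 2 * Λ ^ 2 = 10 * (C * Λ) ^ 2 by ring]
  -- The logarithm in the bound may be tiny when `T * ‖u‖ ≤ m`. There moving the comparator to `0`
  -- costs at most `m ≤ ε`, and `y = 0` gives total regret at most `3 * ε`.
  rcases le_or_gt (T * ‖u‖) m with hsmall | hlarge
  · have h1 := (hA c hc T).1
    have h2 := (hA₁ _ hcost T).1
    have h3 : A.regret c T u ≤ A.regret c T 0 + T * ‖u‖ := by
      have h4 : ∑ t ∈ range T, c t (-u) ≤ ∑ _t ∈ range T, ‖u‖ := Finset.sum_le_sum fun t _ => by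
        have h5 := (le_abs_self _).trans ((c t).le_of_opNorm_le (hc t) (-u))
        rwa [one_mul, norm_neg] at h5
      simp only [map_neg, Finset.sum_neg_distrib, Finset.sum_const, Finset.card_range,
        nsmul_eq_mul] at h4
      simp only [OnlineAlgorithm.regret, map_sub, Finset.sum_sub_distrib, map_zero]
      simp only [Finset.sum_const_zero]
      linarith
    rw [addLearners_regret A A₁ c h T u 0]
    have h4 : 0 ≤ ‖u‖ * Real.log (1 + T * ‖u‖ / m) * (1 + Real.sqrt b) / (min α 1 * μ) := by
      positivity
    nlinarith
  have hu : u ≠ 0 := by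
    rintro rfl
    rw [norm_zero, mul_zero] at hlarge
    linarith
  have hupos : 0 < ‖u‖ := norm_pos_iff.2 hu
  have hμ1 := hE.le_one hu
  -- Beyond the threshold the logarithm is at least `log 2`, so inserting it as a factor only
  -- doubles the constant 5.
  have hlog : 1 / 2 ≤ Real.log (1 + T * ‖u‖ / m) := by
    have h1 : (2 : ℝ) ≤ 1 + T * ‖u‖ / m := by
      have := (one_le_div hmpos).2 hlarge.le
      linarith
    have h2 := Real.log_le_log two_pos h1
    linarith [Real.log_two_gt_d9]
  obtain ⟨S, hS, hcor, hcard⟩ := badCount_attained c h T α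
  have hcardb : (S.card : ℝ) = b := by rw [hcard]
  have hgain := sum_hint_ge hc hh hS hcor
  have hW := sum_norm_sq_le hc hS
  rw [hcardb] at hgain hW
  set V : ℝ := ∑ t ∈ range T \ S, ‖c t‖ ^ 2 with hV
  set W : ℝ := ∑ t ∈ range T, ‖c t‖ ^ 2 with hWdef
  have hV0 : 0 ≤ V := Finset.sum_nonneg fun _ _ => by positivity
  have htrade := hint_tradeoff hupos hb0 hV0 hW hα hμ hμ1 hD
  set M : ℝ := max 1 (α * Real.sqrt (1 + b)) with hM
  have hM1 : 1 ≤ M := le_max_left _ _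
  -- The `1` in `M` keeps `y ≤ ‖u‖`, so the regret of `A₁` obeys the same bound as that of `A`.
  set y : ℝ := ‖u‖ / M with hy
  have hy0 : 0 ≤ y := by positivity
  have hyu : y ≤ ‖u‖ := div_le_self hupos.le hM1
  have hRA := (hA c hc T).2 u
  have hRA₁ : A₁.regret (hintCosts c h) T y ≤
      C * Λ * (ε + ‖u‖ * Real.sqrt ((1 + W) / μ)) := by
    refine ((hA₁ _ hcost T).2 y).trans ?_
    rw [pow_one, Real.norm_of_nonneg hy0]
    have h1 : logFactor T y ε ≤ Λ := logFactor_mono T hy0 hyu hε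
    have h2 : ∑ t ∈ range T, ‖hintCosts c h t‖ ^ 2 ≤ W := Finset.sum_le_sum fun t _ =>
      pow_le_pow_left₀ (norm_nonneg _) (norm_hintCosts_le c hh t) 2
    have h3 : 0 ≤ ∑ t ∈ range T, ‖hintCosts c h t‖ ^ 2 :=
      Finset.sum_nonneg fun _ _ => by positivity
    gcongr
  rw [pow_one] at hRA
  have hgain' := mul_le_mul_of_nonneg_left hgain hy0
  rw [addLearners_regret A A₁ c h T u y]
  have hQ : 5 * (C * Λ) ^ 2 * (‖u‖ * (1 + Real.sqrt b) / (min α 1 * μ)) ≤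
      10 * (C * Λ) ^ 2 *
        (‖u‖ * Real.log (1 + T * ‖u‖ / m) * (1 + Real.sqrt b) / (min α 1 * μ)) := by
    set Q : ℝ := ‖u‖ * (1 + Real.sqrt b) / (min α 1 * μ) with hQ
    have e : ‖u‖ * Real.log (1 + T * ‖u‖ / m) * (1 + Real.sqrt b) / (min α 1 * μ) =
        Real.log (1 + T * ‖u‖ / m) * Q := by
      rw [hQ]
      ring
    have hQ0 : 0 ≤ (C * Λ) ^ 2 * Q := by positivity
    rw [e]
    have := mul_le_mul_of_nonneg_right hlog hQ0
    linarith
  have hDε : C * Λ * ε ≤ (C * Λ) ^ 2 * ε :=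
    mul_le_mul_of_nonneg_right (by nlinarith) hε.le
  nlinarith

end

theorem mainTheorem3 :
    ∃ C : ℝ, 0 < C ∧ ∃ k : ℕ,
      ∀ (E : Type*) [NormedAddCommGroup E] [NormedSpace ℝ E] [CompleteSpace E] (μ : ℝ),
        0 < μ → IsReflexiveSpace E → IsStronglyConvexSpace E μ →
        ∀ ε : ℝ, 0 < ε →
          ∃ B : HintAlgorithm E,
            (∃ (A : OnlineAlgorithm E) (A₁ : OnlineAlgorithm ℝ),
              IsParameterFree A μ ε C k ∧ IsParameterFree A₁ 1 ε C k ∧ B = addLearners A A₁) ∧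
            ∀ (c : ℕ → StrongDual ℝ E) (h : ℕ → E),
              (∀ t, ‖c t‖ ≤ 1) → (∀ t, ‖h t‖ ≤ 1) →
              ∀ (T : ℕ) (α : ℝ), 0 < α → ∀ u : E,
                B.regret c h T u ≤
                  C * logFactor T ‖u‖ ε ^ k *
                    (ε + ‖u‖ * Real.log (1 + T * ‖u‖ / min ε (ε ^ 2)) *
                        (1 + Real.sqrt (badCount c h T α)) / (min α 1 * μ)) := by
  -- The tradeoff squares the factor `52 * Λ` of the learners, hence the exponent 2.
  refine ⟨10 * 52 ^ 2, by norm_num, 2, fun E _ _ _ μ hμ _ hE ε hε => ?_⟩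
  have hA := isParameterFree_parameterFreeLearner hμ hε hE
  have hA₁ := isParameterFree_parameterFreeLearner one_pos hε isStronglyConvexSpace_real
  exact ⟨_, ⟨_, _, hA.mono hε (by norm_num) (by norm_num) one_le_two,
    hA₁.mono hε (by norm_num) (by norm_num) one_le_two, rfl⟩,
    fun c h hc hh T α hα u =>
      addLearners_regret_le hμ hε (by norm_num) hE hA hA₁ hc hh T hα u⟩
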